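/- **Setting.** Let $\Sigma=(X,X_0,U,t)$ be a robotic system with $X_0\subseteq X\subset\mathbb R^n$, $U\subset\mathbb R^m$ and a stochastic kernel $t(\cdot\mid x,u)$ on $X$. For $K=(K',b')\in\mathbb R^{m\times(n+1)}$ write $K(x)=K'x+b'$. Let $L:X\to 2^{AP}$ be a measurable labeling with $AP$ finite, $\varphi$ a BLTL or scLTL formula over $AP$, $H$ a time horizon, and $\mathcal A_\varphi=(S,S_0,2^{AP},G,\delta)$ a deterministic finite automaton with $Z=|S|$ states that is equivalent to $\varphi$ on words of length $H+1$: from every $s\in S_0$, a word $\omega^{(0)}\dots\omega^{(H)}$ satisfies $\varphi$ (i.e. all of its infinite extensions do) iff its run visits $G$. For a controller $C_k:X\times S\to U$, the closed-loop trajectory $\xi_C^{(x,s)}$ is the Markov process $(x^{(k)},s^{(k)})$ with $x^{(0)}=x$, $s^{(0)}=\delta(s,L(x))$, $x^{(k+1)}\sim t(\cdot\mid x^{(k)},C_k(x^{(k)},s^{(k)}))$, $s^{(k+1)}=\delta(s^{(k)},L(x^{(k+1)}))$; and $\xi_C^{(x,s)}\models\varphi$ means that $L(x^{(0)})\dots L(x^{(H)})$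 satisfies $\varphi$. $X$ is partitioned into abstract states $q_1,\dots,q_N$: measurable infinity-norm balls with centers $\mathrm{ct}(q_i)$, of Euclidean diameter at most $\eta_q$, covering $X$, with disjoint interiors and with overlaps not charged by $t(\cdot\mid x,u)$. The measurable map $\mathrm{abs}$ sends $x$ to an abstract state containing $x$, and labels are compatible with the partition: $L(x)=\hat L(\mathrm{abs}(x))$. A controller space $\mathcal P^{K\times b}\subset\mathbb R^{m\times(n+1)}$ with $K(x)\in U$ for all $K\in\mathcal P^{K\times b}$, $x\in X$ is partitioned into balls $\mathcal P_1,\dots,\mathcal P_M$ of the max norm with centers $\mathrm{ct}(\mathcal P_j)$, of diameter at most $\eta_{\mathcal P}$ in that norm, with disjoint interiors. Let $\hat t(q'\mid q,\mathcal P)=t(q'\mid z,\kappa(z))$ with $z=\mathrm{ct}(q)$, $\kappa=\mathrm{ct}(\mathcal P)$. Put $\hat V^*_H(q,s)=\mathbf 1_G(s)$, $\hat Q_k(q,s,\mathcal P)=1$ if $s\in G$, $\hat Q_k(q,s,\mathcal P)=\sum_{q'}\hat V^*_{k+1}(q',\delta(s,\hat L(q')))\,\hat t(q'\mid q,\mathcal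 P)$ if $s\notin G$, and $\hat V_k^*(q,s)=\max_{\mathcal P}\hat Q_k(q,s,\mathcal P)$. For each pair $(q,\mathcal P)$ let $NN_{(q,\mathcal P)}$ be a ReLU network with $NN_{(q,\mathcal P)}|_q\in\mathcal P$, i.e. the parameters of its affine pieces on the linear regions that meet $q$ lie in $\mathcal P$. The neurosymbolic planner $NN_{[\mathfrak{NN},\Gamma]}$ applies at time $k$ in $(x,s)$ the action $NN_{(q,\mathcal P^*)}(x)$ with $q=\mathrm{abs}(x)$ and $\mathcal P^*$ a maximizer of $\hat Q_k(q,s,\cdot)$. **Constants.** Let $\mu$ be a measure on $X$ and let $\lambda_i,\beta_i\ge0$ be $\mu$-integrable with $|t(dy|x',u)-t(dy|x,u)|\le\lambda_i(y)\|x'-x\|\mu(dy)$ for $x,x'\in q_i$, $u\in U$, and $|t(dy|x,u')-t(dy|x,u)|\le\beta_i(y)\|u'-u\|\mu(dy)$ for $x\in q_i$, $u,u'\in U$. Put $\Lambda_i=\int\lambda_i\,d\mu$ and $B_i=\int\beta_i\,d\mu$. Let $L_i\geq 0$ be a common Lipschitz constant on $q_i$ of all networks $NN_{(q_i,\mathcal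 P)}$, let $\mathcal L_X\ge1$ with $\sup_{x\in X}\|x\|\le\mathcal L_X$, and let $\sup_{K\in\mathcal P^{K\times b}}\|K\|\le\mathcal L_{\mathcal P}$ (Euclidean norm, induced 2-norm). Put $$\Delta^{NN}=\max_{i}\big(\Lambda_i\eta_q+B_iL_i\eta_q+\sqrt{m(n+1)}\,\mathcal L_XB_i\eta_{\mathcal P}\big),\qquad \Delta^{*}=\max_{i}\big(\Lambda_i\eta_q+B_i\mathcal L_{\mathcal P}\eta_q+2\sqrt{m(n+1)}\,\mathcal L_XB_i\eta_{\mathcal P}\big).$$ **Theorem.** Let $\mathcal C^*_\varphi$ be an optimal controller: a (possibly time-dependent) measurable controller $X\times S\to U$, each of whose actions at a state $x$ has the form $K(x)$ with some $K\in\mathcal P^{K\times b}$, that maximizes $\Pr(\xi_C^{(x,s)}\models\varphi)$ for all $x\in X_0$, $s\in S_0$ among all such controllers $C$. (If every $u\in U$ has this form at every $x\in X$, these are all measurable controllers $X\times S\to U$.) Then for all $x\in X_0$ and $s\in S_0$ $$\Big|\Pr\big(\xi^{(x,s)}_{NN_{[\mathfrak{NN},\Gamma]}}\models\varphi\big)-\Pr\big(\xi^{(x,s)}_{\mathcal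 C^*_\varphi}\models\varphi\big)\Big|\le HZ\,(\Delta^{NN}+\Delta^*).$$ The same bound holds for the probabilities that $(x^{(k)},s^{(k)})$, started in an arbitrary $(x,s)\in X\times S$ (with $s^{(0)}=s$), reaches $X\times G$ within $H$ steps, if $\mathcal C^*_\varphi$ maximizes these probabilities. -/

import Mathlib

open MeasureTheory ProbabilityTheory
open scoped NNReal

namespace Neurosym

/-! ### Vectors, affine controllers and infinity-norm balls -/

/-- `ℝⁿ` with the Euclidean norm. -/
abbrev Vec (n : ℕ) := EuclideanSpace ℝ (Fin n)

/-- Parameters `K = (K', b') ∈ ℝ^{m × (n+1)}` of an affine controller; `b'` is the last column. -/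
abbrev Params (m n : ℕ) := Matrix (Fin m) (Fin (n + 1)) ℝ

/-- The affine controller `K(x) = K' x + b'`. -/
noncomputable def ctrlEval {m n : ℕ} (K : Params m n) (x : Vec n) : Vec m :=
  WithLp.toLp 2 fun i => ∑ j : Fin n, K i j.castSucc * x j + K i (Fin.last n)

/-- The induced 2-norm of a matrix. -/
noncomputable def opNorm {m k : ℕ} (A : Matrix (Fin m) (Fin k) ℝ) : ℝ :=
  ‖LinearMap.toContinuousLinearMap (Matrix.toEuclideanLin A)‖

/-- `q` is an infinity-norm ball in `ℝⁿ` with center `c` and radius `r` (any part of the boundary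
may belong to `q`). -/
def IsInftyBall {n : ℕ} (c : Vec n) (r : ℝ) (q : Set (Vec n)) : Prop :=
  0 < r ∧ {x | ∀ i, |x i - c i| < r} ⊆ q ∧ q ⊆ {x | ∀ i, |x i - c i| ≤ r}

/-- `P` is a ball of the max norm on `ℝ^{m × (n+1)}` with center `c` and radius `r` (any part of
the boundary may belong to `P`). -/
def IsMaxBall {m n : ℕ} (c : Params m n) (r : ℝ) (P : Set (Params m n)) : Prop :=
  0 < r ∧ {K | ∀ i j, |K i j - c i j| < r} ⊆ P ∧ P ⊆ {K | ∀ i j, |K i j - c i j| ≤ r}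

/-! ### ReLU networks and continuous piecewise affine functions -/

/-- ReLU networks with `i` inputs and `o` outputs, as lists of layers. The `max` of the output
layer is omitted; an output layer with `max` is a hidden layer followed by the identity layer. -/
inductive ReLUNet : ℕ → ℕ → Type
  | output {i o : ℕ} (W : Matrix (Fin o) (Fin i) ℝ) (b : Fin o → ℝ) : ReLUNet i o
  | layer {i h o : ℕ} (W : Matrix (Fin h) (Fin i) ℝ) (b : Fin h → ℝ) (rest : ReLUNet h o) :
      ReLUNet i o

/-- The function computed by a ReLU network. -/
def ReLUNet.evalFun : {i o : ℕ} → ReLUNet i o → (Fin i → ℝ) → (Fin o → ℝ)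
  | _, _, .output W b, z => W.mulVec z + b
  | _, _, .layer W b rest, z => rest.evalFun (fun k => max ((W.mulVec z + b) k) 0)

/-- The function computed by a ReLU network, between Euclidean spaces. -/
noncomputable def ReLUNet.eval {n m : ℕ} (𝒩 : ReLUNet n m) (x : Vec n) : Vec m :=
  WithLp.toLp 2 (𝒩.evalFun x.ofLp)

/-- A polyhedron: a finite intersection of closed half-spaces. -/
def IsPolyhedron {n : ℕ} (R : Set (Vec n)) : Prop :=
  ∃ (p : ℕ) (a : Fin p → Vec n) (c : Fin p → ℝ), R = {x | ∀ l, inner ℝ (a l) x ≤ c l}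

/-- `f|_q ∈ P`: the function `f : X → ℝᵐ` is continuous piecewise affine, `f(x) = K_l(x)` on the
linear region `R_l`, and `K_l ∈ P` for every linear region `R_l` that meets `q`. -/
def RestrictsTo {n m : ℕ} (X q : Set (Vec n)) (P : Set (Params m n)) (f : Vec n → Vec m) : Prop :=
  ContinuousOn f X ∧
  ∃ (p : ℕ) (R : Fin p → Set (Vec n)) (K : Fin p → Params m n),
    (∀ l, IsPolyhedron (R l)) ∧ X ⊆ ⋃ l, R l ∧
    (∀ l l', l ≠ l' → Disjoint (interior (R l)) (interior (R l'))) ∧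
    (∀ l, ∀ x ∈ R l ∩ X, f x = ctrlEval (K l) x) ∧
    (∀ l, (R l ∩ q).Nonempty → K l ∈ P)

/-! ### Temporal logic specifications -/

/-- Bounded linear temporal logic over the atomic propositions `AP`. -/
inductive BLTL (AP : Type) : Type
  | atom (σ : AP) : BLTL AP
  | neg (φ : BLTL AP) : BLTL AP
  | or (φ ψ : BLTL AP) : BLTL AP
  | untl (k₁ k₂ : ℕ) (hk : k₁ < k₂) (φ ψ : BLTL AP) : BLTL AP

/-- `φ.Sat w i`: the word `w` satisfies `φ` at position `i`. -/
def BLTL.Sat {AP : Type} (w : ℕ → Set AP) : BLTL AP → ℕ → Prop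
  | .atom σ, i => σ ∈ w i
  | .neg φ, i => ¬ φ.Sat w i
  | .or φ ψ, i => φ.Sat w i ∨ ψ.Sat w i
  | .untl k₁ k₂ _ φ ψ, i =>
      ∃ k, k₁ ≤ k ∧ k ≤ k₂ ∧ ψ.Sat w (i + k) ∧ ∀ j < k, φ.Sat w (i + j)

/-- Syntactically co-safe linear temporal logic over `AP`. -/
inductive ScLTL (AP : Type) : Type
  | tt : ScLTL AP
  | atom (σ : AP) : ScLTL AP
  | natom (σ : AP) : ScLTL AP
  | or (φ ψ : ScLTL AP) : ScLTL AP
  | and (φ ψ : ScLTL AP) : ScLTL AP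
  | next (φ : ScLTL AP) : ScLTL AP
  | untl (φ ψ : ScLTL AP) : ScLTL AP

/-- `φ.Sat w i`: the word `w` satisfies `φ` at position `i`. -/
def ScLTL.Sat {AP : Type} (w : ℕ → Set AP) : ScLTL AP → ℕ → Prop
  | .tt, _ => True
  | .atom σ, i => σ ∈ w i
  | .natom σ, i => σ ∉ w i
  | .or φ ψ, i => φ.Sat w i ∨ ψ.Sat w i
  | .and φ ψ, i => φ.Sat w i ∧ ψ.Sat w i
  | .next φ, i => φ.Sat w (i + 1)
  | .untl φ ψ, i => ∃ k, ψ.Sat w (i + k) ∧ ∀ j < k, φ.Sat w (i + j)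

/-- Mission specifications: BLTL or scLTL formulas. -/
inductive Spec (AP : Type) : Type
  | bltl (φ : BLTL AP) : Spec AP
  | scltl (φ : ScLTL AP) : Spec AP

/-- Satisfaction by an infinite word. -/
def Spec.Sat {AP : Type} (w : ℕ → Set AP) : Spec AP → Prop
  | .bltl φ => φ.Sat w 0
  | .scltl φ => φ.Sat w 0

/-- Satisfaction by the finite word `w⁽⁰⁾ … w⁽ᴴ⁾`: every infinite word that extends it satisfies
`φ`. (For scLTL: the finite word contains a good prefix. For a BLTL formula whose time bounds
fit into the horizon `H`, satisfaction depends on `w⁽⁰⁾ … w⁽ᴴ⁾` only.) -/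
def Spec.SatUpTo {AP : Type} (H : ℕ) (w : ℕ → Set AP) (φ : Spec AP) : Prop :=
  ∀ w' : ℕ → Set AP, (∀ k ≤ H, w' k = w k) → φ.Sat w'

/-- Deterministic finite-state automata over the alphabet `2^AP` (the state set `S` is a finite
type), with initial states `S₀` and accepting set `G`. -/
structure Automaton (AP S : Type) where
  init : Set S
  acc : Set S
  δ : S → Set AP → S

/-- The state after reading the letters `w⁽⁰⁾, …, w⁽ᵏ⁾` from `s`. -/
def Automaton.run {AP S : Type} (𝒜 : Automaton AP S) (s : S) (w : ℕ → Set AP) : ℕ → S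
  | 0 => 𝒜.δ s (w 0)
  | k + 1 => 𝒜.δ (𝒜.run s w k) (w (k + 1))

/-- The automaton is equivalent to `φ` on words of length `H + 1`: from any initial state, such
a word satisfies `φ` if and only if its run reaches the accepting set. -/
def Automaton.EquivSpec {AP S : Type} (𝒜 : Automaton AP S) (φ : Spec AP) (H : ℕ) : Prop :=
  ∀ s ∈ 𝒜.init, ∀ w : ℕ → Set AP, φ.SatUpTo H w ↔ ∃ k ≤ H, 𝒜.run s w k ∈ 𝒜.acc

/-! ### The robotic system, its labels and the partitions -/

/-- A robotic system `(X, X₀, U, t)` with states `X ⊆ ℝⁿ`, actions `U ⊆ ℝᵐ` and a stochastic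
kernel `t`. -/
structure RobotSystem (n m : ℕ) where
  X : Set (Vec n)
  U : Set (Vec m)
  X₀ : Set X
  t : Kernel (X × U) X
  markov : IsMarkovKernel t

/-- A labeling function `L : X → 2^AP`. -/
structure Labeling {n m : ℕ} (Sys : RobotSystem n m) (AP : Type) where
  L : Sys.X → Set AP
  meas : ∀ σ, MeasurableSet {x | σ ∈ L x}

/-- Partition of the state space into `N` infinity-norm balls (the abstract states), compatible
with the labels, and of the controller space `𝒫^{K×b}` into `M` max-norm balls, all of whose
controllers take values in `U` on `X`. The abstract states overlap at most in sets that the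
kernel does not charge. -/
structure Grid {n m : ℕ} (Sys : RobotSystem n m) {AP : Type} (Lab : Labeling Sys AP)
    (N M : ℕ) where
  /-- abstract states -/
  cell : Fin N → Set (Vec n)
  ctr : Fin N → Vec n
  rad : Fin N → ℝ
  cell_ball : ∀ i, IsInftyBall (ctr i) (rad i) (cell i)
  cell_meas : ∀ i, MeasurableSet (cell i)
  cell_cover : ⋃ i, cell i = Sys.X
  cell_disj : ∀ i i', i ≠ i' → Disjoint (interior (cell i)) (interior (cell i'))
  cell_null : ∀ i i', i ≠ i' → ∀ y : Sys.X × Sys.U, Sys.t y {x' | x'.1 ∈ cell i ∩ cell i'} = 0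
  /-- the map that assigns to a state an abstract state containing it -/
  abs : Sys.X → Fin N
  abs_meas : Measurable abs
  abs_mem : ∀ x : Sys.X, x.1 ∈ cell (abs x)
  /-- labels of abstract states -/
  absL : Fin N → Set AP
  absL_eq : ∀ x : Sys.X, Lab.L x = absL (abs x)
  /-- the controller space `𝒫^{K×b}` -/
  ctrl : Set (Params m n)
  ctrl_maps : ∀ K ∈ ctrl, ∀ x ∈ Sys.X, ctrlEval K x ∈ Sys.U
  /-- controller partitions -/
  part : Fin M → Set (Params m n)
  kctr : Fin M → Params m n
  krad : Fin M → ℝ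
  part_ball : ∀ j, IsMaxBall (kctr j) (krad j) (part j)
  part_cover : ⋃ j, part j = ctrl
  part_disj : ∀ j j', j ≠ j' → Disjoint (interior (part j)) (interior (part j'))

section

variable {n m N M : ℕ} {Sys : RobotSystem n m} {AP S : Type} {Lab : Labeling Sys AP}

theorem Grid.ctr_mem_cell (Gr : Grid Sys Lab N M) (i : Fin N) : Gr.ctr i ∈ Gr.cell i :=
  (Gr.cell_ball i).2.1 fun k => by simpa using (Gr.cell_ball i).1

theorem Grid.cell_subset (Gr : Grid Sys Lab N M) (i : Fin N) : Gr.cell i ⊆ Sys.X := by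
  rw [← Gr.cell_cover]; exact Set.subset_iUnion _ i

theorem Grid.part_subset (Gr : Grid Sys Lab N M) (j : Fin M) : Gr.part j ⊆ Gr.ctrl := by
  rw [← Gr.part_cover]; exact Set.subset_iUnion _ j

theorem Grid.kctr_mem_part (Gr : Grid Sys Lab N M) (j : Fin M) : Gr.kctr j ∈ Gr.part j :=
  (Gr.part_ball j).2.1 fun k l => by simpa using (Gr.part_ball j).1

/-- The center `z` of the abstract state `i`, as a state. -/
def Grid.center (Gr : Grid Sys Lab N M) (i : Fin N) : Sys.X :=
  ⟨Gr.ctr i, Gr.cell_subset i (Gr.ctr_mem_cell i)⟩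

/-- The action `κ(z)` of the center `κ` of controller partition `j` at the center `z` of the
abstract state `i`. -/
noncomputable def Grid.centerAction (Gr : Grid Sys Lab N M) (i : Fin N) (j : Fin M) : Sys.U :=
  ⟨ctrlEval (Gr.kctr j) (Gr.ctr i), Gr.ctrl_maps _ (Gr.part_subset j (Gr.kctr_mem_part j)) _
    (Gr.cell_subset i (Gr.ctr_mem_cell i))⟩

/-! ### The symbolic model, its product with the automaton, and dynamic programming -/

/-- Transition probabilities `t̂(q' | q, 𝒫)` of the symbolic model. -/
noncomputable def Grid.absT (Gr : Grid Sys Lab N M) (q' q : Fin N) (j : Fin M) : ℝ :=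
  (Sys.t (Gr.center q, Gr.centerAction q j)).real {x' | x'.1 ∈ Gr.cell q'}

open Classical in
/-- Transition probabilities of the product MDP. -/
noncomputable def Grid.prodT (Gr : Grid Sys Lab N M) (𝒜 : Automaton AP S) (y' y : Fin N × S)
    (j : Fin M) : ℝ :=
  if y'.2 = 𝒜.δ y.2 (Gr.absL y'.1) then Gr.absT y'.1 y.1 j else 0

open Classical in
/-- One step of the recursion: `Q̂_k(q, s, 𝒫)` in terms of `V = V̂*_{k+1}`. -/
noncomputable def Grid.absQ [Fintype S] (Gr : Grid Sys Lab N M) (𝒜 : Automaton AP S)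
    (V : Fin N × S → ℝ) (y : Fin N × S) (j : Fin M) : ℝ :=
  if y.2 ∈ 𝒜.acc then 1 else ∑ y' : Fin N × S, V y' * Gr.prodT 𝒜 y' y j

open Classical in
/-- Optimal value functions of the product MDP, indexed by the number of remaining steps: with
horizon `H`, `V̂*_k` is `absV 𝒜 (H - k)`. -/
noncomputable def Grid.absV [Fintype S] (Gr : Grid Sys Lab N M) (𝒜 : Automaton AP S) :
    ℕ → Fin N × S → ℝ
  | 0, y => if y.2 ∈ 𝒜.acc then 1 else 0
  | r + 1, y => ⨆ j : Fin M, Gr.absQ 𝒜 (Gr.absV 𝒜 r) y j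

/-- `Γ` selects, at every time `k < H`, a maximizer of `Q̂_k(q, s, ·)`: the selected local network
at `(q, s)` has the index `(q, Γ k q s)`. -/
def Grid.IsSelection [Fintype S] (Gr : Grid Sys Lab N M) (𝒜 : Automaton AP S) (H : ℕ)
    (Γ : ℕ → Fin N → S → Fin M) : Prop :=
  ∀ k < H, ∀ q s j,
    Gr.absQ 𝒜 (Gr.absV 𝒜 (H - (k + 1))) (q, s) j ≤
      Gr.absQ 𝒜 (Gr.absV 𝒜 (H - (k + 1))) (q, s) (Γ k q s)

/-- A library of local networks: one network for every pair `(q, 𝒫)`, feasible for the formal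
training problem, that is, with `NN|_q ∈ 𝒫`. -/
structure Library (Gr : Grid Sys Lab N M) where
  net : Fin N → Fin M → ReLUNet n m
  constraint : ∀ i j, RestrictsTo Sys.X (Gr.cell i) (Gr.part j) (net i j).eval

/-! ### Controllers and closed-loop trajectories -/

/-- Time-dependent controllers `C_k : X × S → U`. -/
structure Controller (Sys : RobotSystem n m) (S : Type) [MeasurableSpace S] where
  act : ℕ → Sys.X × S → Sys.U
  meas : ∀ k, Measurable (act k)

/-- The controller draws its actions from the controller space: at every time and state, the
action is `K(x)` for some `K ∈ 𝒫^{K×b}`. -/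
def Controller.Admissible [MeasurableSpace S] (C : Controller Sys S) (Gr : Grid Sys Lab N M) :
    Prop :=
  ∀ k (y : Sys.X × S), ∃ K ∈ Gr.ctrl, (C.act k y : Vec m) = ctrlEval K y.1

theorem Library.eval_eq {Gr : Grid Sys Lab N M} (𝔏 : Library Gr) (i : Fin N) (j : Fin M)
    {x : Vec n} (hx : x ∈ Gr.cell i) : ∃ K ∈ Gr.part j, (𝔏.net i j).eval x = ctrlEval K x := by
  obtain ⟨-, p, R, K, -, hcov, -, hf, hK⟩ := 𝔏.constraint i j
  obtain ⟨l, hl⟩ := Set.mem_iUnion.1 (hcov (Gr.cell_subset i hx))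
  exact ⟨K l, hK l ⟨x, hl, hx⟩, hf l x ⟨hl, Gr.cell_subset i hx⟩⟩

theorem ReLUNet.continuous_evalFun {i o : ℕ} (𝒩 : ReLUNet i o) : Continuous 𝒩.evalFun := by
  induction 𝒩 with
  | output W b =>
    have : (ReLUNet.output W b).evalFun = fun z => W.mulVec z + b := by
      funext z; simp [ReLUNet.evalFun]
    rw [this]
    exact (Continuous.matrix_mulVec continuous_const continuous_id).add continuous_const
  | layer W b rest ih =>
    have : (ReLUNet.layer W b rest).evalFun =
        fun z => rest.evalFun (fun k => max ((W.mulVec z + b) k) 0) := by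
      funext z; simp [ReLUNet.evalFun]
    rw [this]
    refine ih.comp (continuous_pi fun k => ?_)
    refine Continuous.max ?_ continuous_const
    exact (continuous_apply k).comp
      ((Continuous.matrix_mulVec continuous_const continuous_id).add continuous_const)

theorem ReLUNet.continuous_eval (𝒩 : ReLUNet n m) : Continuous 𝒩.eval :=
  (PiLp.continuous_toLp 2 _).comp (𝒩.continuous_evalFun.comp (PiLp.continuous_ofLp 2 _))

/-- The neurosymbolic planner: at time `k`, robot state `x` and automaton state `s`, apply the
local network with index `(q, Γ k q s)`, where `q = abs(x)`. -/
noncomputable def planner [MeasurableSpace S] [Countable S] [DiscreteMeasurableSpace S]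
    {Gr : Grid Sys Lab N M} (𝔏 : Library Gr) (Γ : ℕ → Fin N → S → Fin M) : Controller Sys S where
  act k y := ⟨(𝔏.net (Gr.abs y.1) (Γ k (Gr.abs y.1) y.2)).eval y.1, by
    obtain ⟨K, hK, h⟩ := 𝔏.eval_eq (Gr.abs y.1) (Γ k (Gr.abs y.1) y.2) (Gr.abs_mem y.1)
    rw [h]
    exact Gr.ctrl_maps K (Gr.part_subset _ hK) _ y.1.2⟩
  meas k := by
    refine Measurable.subtype_mk ?_
    have h : Measurable fun p : (Fin N × S) × Vec n =>
        (𝔏.net p.1.1 (Γ k p.1.1 p.1.2)).eval p.2 :=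
      measurable_from_prod_countable_right fun p => (𝔏.net p.1 (Γ k p.1 p.2)).continuous_eval.measurable
    exact h.comp (((Gr.abs_meas.comp measurable_fst).prodMk measurable_snd).prodMk
      (measurable_subtype_coe.comp measurable_fst))

theorem measurable_step [Finite AP] [Countable S] [MeasurableSpace S] [DiscreteMeasurableSpace S]
    (Lab : Labeling Sys AP) (𝒜 : Automaton AP S) :
    Measurable fun p : (Sys.X × S) × Sys.X => (p.2, 𝒜.δ p.1.2 (Lab.L p.2)) := by
  have hL : ∀ a : Set AP, MeasurableSet (Lab.L ⁻¹' {a}) := by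
    intro a
    have : Lab.L ⁻¹' {a} = ⋂ σ, {x | σ ∈ Lab.L x ↔ σ ∈ a} := by
      ext x; simp [Set.ext_iff]
    rw [this]
    refine MeasurableSet.iInter fun σ => ?_
    by_cases h : σ ∈ a
    · simp only [h, iff_true]
      exact Lab.meas σ
    · simp only [h, iff_false]
      exact (Lab.meas σ).compl
  refine measurable_snd.prodMk ?_
  have : ∀ s, Measurable fun x : Sys.X => 𝒜.δ s (Lab.L x) := by
    intro s u _
    have : (fun x : Sys.X => 𝒜.δ s (Lab.L x)) ⁻¹' u
        = ⋃ a ∈ {a | 𝒜.δ s a ∈ u}, Lab.L ⁻¹' {a} := by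
      ext x; simp
    rw [this]
    exact MeasurableSet.biUnion (Set.to_countable _) fun a _ => hL a
  have h2 : Measurable fun p : S × Sys.X => 𝒜.δ p.1 (Lab.L p.2) :=
    measurable_from_prod_countable_right this
  exact h2.comp ((measurable_snd.comp measurable_fst).prodMk measurable_snd)

variable [Finite AP] [Countable S] [MeasurableSpace S] [DiscreteMeasurableSpace S]

/-- The closed-loop kernel of the product of the system with the automaton, at time `k`: from
`(x, s)` the next state is `(x', δ(s, L(x')))` with `x'` of law `t(· | x, C_k(x, s))`. -/
noncomputable def Controller.stepKernel (C : Controller Sys S) (Lab : Labeling Sys AP)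
    (𝒜 : Automaton AP S) (k : ℕ) : Kernel (Sys.X × S) (Sys.X × S) :=
  (Kernel.id ×ₖ Sys.t.comap (fun y : Sys.X × S => (y.1, C.act k y))
    (measurable_fst.prodMk (C.meas k))).map fun p => (p.2, 𝒜.δ p.1.2 (Lab.L p.2))

instance (C : Controller Sys S) (Lab : Labeling Sys AP) (𝒜 : Automaton AP S) (k : ℕ) :
    IsMarkovKernel (C.stepKernel Lab 𝒜 k) :=
  have := Sys.markov
  Kernel.IsMarkovKernel.map _ (measurable_step Lab 𝒜)

/-- The law of the closed-loop trajectory `(x⁽⁰⁾, s⁽⁰⁾), (x⁽¹⁾, s⁽¹⁾), …` started at `y`. -/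
noncomputable def Controller.law (C : Controller Sys S) (Lab : Labeling Sys AP)
    (𝒜 : Automaton AP S) (y : Sys.X × S) : Measure (ℕ → Sys.X × S) :=
  Kernel.traj (X := fun _ : ℕ => Sys.X × S)
    (fun k => (C.stepKernel Lab 𝒜 k).comap
      (fun h : (i : Finset.Iic k) → Sys.X × S => h ⟨k, Finset.mem_Iic.2 le_rfl⟩)
      (measurable_pi_apply _)) 0 (fun _ => y)

/-- `Pr(ξ^{(x, s)} ⊨ φ)`: the probability that the closed-loop trajectory `x⁽⁰⁾ … x⁽ᴴ⁾`, with the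
robot starting from `x` and the automaton starting from `s` (its first letter is `L(x)`),
satisfies `φ`. -/
noncomputable def Controller.satProb (C : Controller Sys S) (Lab : Labeling Sys AP)
    (𝒜 : Automaton AP S) (φ : Spec AP) (H : ℕ) (x : Sys.X) (s : S) : ℝ :=
  (C.law Lab 𝒜 (x, 𝒜.δ s (Lab.L x))).real {ξ | φ.SatUpTo H fun k => Lab.L (ξ k).1}

/-- The probability that the product, started at `(x, s)`, reaches the accepting set within `H`
steps. -/
noncomputable def Controller.reachProb (C : Controller Sys S) (Lab : Labeling Sys AP)
    (𝒜 : Automaton AP S) (H : ℕ) (x : Sys.X) (s : S) : ℝ :=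
  (C.law Lab 𝒜 (x, s)).real {ξ | ∃ k ≤ H, (ξ k).2 ∈ 𝒜.acc}

end

/-! ### The constants of the bound -/

/-- `|t(dy | x', u) - t(dy | x, u)| ≤ l_i(y) ‖x' - x‖ μ(dy)` for `x, x' ∈ q_i` and `u ∈ U`, as an
inequality between measures. -/
def LipschitzInState {n m N M : ℕ} {Sys : RobotSystem n m} {AP : Type} {Lab : Labeling Sys AP}
    (Gr : Grid Sys Lab N M) (μ : Measure Sys.X) (l : Fin N → Sys.X → ℝ) : Prop :=
  ∀ i, 0 ≤ l i ∧ Integrable (l i) μ ∧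
    ∀ x x' : Sys.X, x.1 ∈ Gr.cell i → x'.1 ∈ Gr.cell i → ∀ u : Sys.U,
      ∀ A : Set Sys.X, MeasurableSet A →
        |(Sys.t (x', u)).real A - (Sys.t (x, u)).real A| ≤ ‖x'.1 - x.1‖ * ∫ y in A, l i y ∂μ

/-- `|t(dy | x, u') - t(dy | x, u)| ≤ b_i(y) ‖u' - u‖ μ(dy)` for `x ∈ q_i` and `u, u' ∈ U`, as an
inequality between measures. -/
def LipschitzInAction {n m N M : ℕ} {Sys : RobotSystem n m} {AP : Type} {Lab : Labeling Sys AP}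
    (Gr : Grid Sys Lab N M) (μ : Measure Sys.X) (b : Fin N → Sys.X → ℝ) : Prop :=
  ∀ i, 0 ≤ b i ∧ Integrable (b i) μ ∧
    ∀ x : Sys.X, x.1 ∈ Gr.cell i → ∀ u u' : Sys.U,
      ∀ A : Set Sys.X, MeasurableSet A →
        |(Sys.t (x, u')).real A - (Sys.t (x, u)).real A| ≤ ‖u'.1 - u.1‖ * ∫ y in A, b i y ∂μ

/-- `Δ^NN = max_i (Λ_i η_q + B_i L_i η_q + √(m(n+1)) 𝓛_X B_i η_𝒫)`. -/
noncomputable def deltaNN (n m : ℕ) {N : ℕ} (Λ B : Fin N → ℝ) (Lnet : Fin N → ℝ≥0)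
    (LX ηq ηP : ℝ) : ℝ :=
  ⨆ i : Fin N, (Λ i * ηq + B i * Lnet i * ηq + √(m * (n + 1)) * LX * B i * ηP)

/-- `Δ* = max_i (Λ_i η_q + B_i 𝓛_𝒫 η_q + 2 √(m(n+1)) 𝓛_X B_i η_𝒫)`. -/
noncomputable def deltaStar (n m : ℕ) {N : ℕ} (Λ B : Fin N → ℝ) (LP LX ηq ηP : ℝ) : ℝ :=
  ⨆ i : Fin N, (Λ i * ηq + B i * LP * ηq + 2 * √(m * (n + 1)) * LX * B i * ηP)

end Neurosym

open Neurosym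

namespace Neurosym

/-! Both controllers are compared with the same optimal symbolic value `Grid.absV`. Almost surely
the automaton component of the trajectory is the run on the labels, so satisfaction of `φ` is
reachability of the accepting set (`satProb_eq_reachProb`). The Markov property then turns the
reachability probability into a backward recursion (`reachProb_eq_reachValue`).

In one step from `x` in a cell with center `z`, the true law and the symbolic law at `(z, κ(z))`
differ, against functions with values in `[0, 1]`, by at most the Lipschitz cost of moving the state
to `z` and the action to `κ(z)` (`lintegral_kernel_le`). For an admissible action `K(x)` and the `κ`
of the partition containing `K`, this cost is at most `Δ*`; for the planner and the `κ` selected by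
`Γ` it is at most `Δ^NN`.

By backward induction these errors add up: an admissible controller exceeds the symbolic optimum by
at most `H Δ*` (`reachValue_le_absV_add`), and the planner falls short of it by at most `H Δ^NN`
(`absV_le_reachValue_add`). Optimality fixes the sign of the gap, since the planner is itself
admissible. This yields `H (Δ^NN + Δ*)`; the factor `Z ≥ 1` is slack. -/

theorem measurableSet_snd_mem_acc {X : Type*} {AP S : Type} [MeasurableSpace X] [MeasurableSpace S]
    [DiscreteMeasurableSpace S] (𝒜 : Automaton AP S) : MeasurableSet {y : X × S | y.2 ∈ 𝒜.acc} :=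
  measurable_snd (MeasurableSet.of_discrete (s := 𝒜.acc))

/-! ### Closed-loop trajectories: from satisfaction to reachability to backward recursion. -/

section Trajectory

variable {n m : ℕ} {Sys : RobotSystem n m} {AP S : Type} {Lab : Labeling Sys AP}
  [Finite AP] [Countable S] [MeasurableSpace S] [DiscreteMeasurableSpace S]

instance (C : Controller Sys S) (Lab : Labeling Sys AP) (𝒜 : Automaton AP S) (y : Sys.X × S) :
    IsProbabilityMeasure (C.law Lab 𝒜 y) := by
  unfold Controller.law; infer_instance

theorem lintegral_stepKernel (C : Controller Sys S) (𝒜 : Automaton AP S) (k : ℕ)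
    (y : Sys.X × S) {f : Sys.X × S → ENNReal} (hf : Measurable f) :
    ∫⁻ y', f y' ∂(C.stepKernel Lab 𝒜 k y) =
      ∫⁻ x', f (x', 𝒜.δ y.2 (Lab.L x')) ∂(Sys.t (y.1, C.act k y)) := by
  have := Sys.markov
  have hstep := measurable_step (Sys := Sys) Lab 𝒜
  rw [Controller.stepKernel, Kernel.map_apply _ hstep, lintegral_map hf hstep,
    Kernel.lintegral_id_prod (f := fun p : (Sys.X × S) × Sys.X => f (p.2, 𝒜.δ p.1.2 (Lab.L p.2)))
    (hf.comp hstep),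
    Kernel.comap_apply]

/-- The Markov property of the closed-loop trajectory. -/
theorem lintegral_law_succ (C : Controller Sys S) (𝒜 : Automaton AP S) (y : Sys.X × S) (k : ℕ)
    {F : ((i : Finset.Iic k) → Sys.X × S) × (Sys.X × S) → ENNReal} (hF : Measurable F) :
    ∫⁻ ξ, F (Preorder.frestrictLe (π := fun _ => Sys.X × S) k ξ, ξ (k + 1)) ∂(C.law Lab 𝒜 y) =
      ∫⁻ ξ, ∫⁻ y', F (Preorder.frestrictLe (π := fun _ => Sys.X × S) k ξ, y')
        ∂(C.stepKernel Lab 𝒜 k (ξ k)) ∂(C.law Lab 𝒜 y) := by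
  unfold Controller.law
  let κ : (k : ℕ) → Kernel ((i : Finset.Iic k) → Sys.X × S) (Sys.X × S) := fun k =>
    (C.stepKernel Lab 𝒜 k).comap
      (fun h : (i : Finset.Iic k) → Sys.X × S => h ⟨k, Finset.mem_Iic.2 le_rfl⟩)
      (measurable_pi_apply _)
  have hm : Measurable fun ξ : ℕ → Sys.X × S =>
      (Preorder.frestrictLe (π := fun _ => Sys.X × S) k ξ, ξ (k + 1)) := by fun_prop
  -- The joint law of the history up to `k` and the next state is the history law composed with the
  -- one-step kernel.
  have h := Kernel.partialTraj_compProd_eq_map_traj (X := fun _ => Sys.X × S) (κ := κ)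
    (Nat.zero_le k) (x₀ := fun _ => y)
  rw [← lintegral_map hF hm, ← h, Measure.lintegral_compProd hF,
    ← Kernel.traj_map_frestrictLe_apply, lintegral_map]
  · rfl
  · exact hF.lintegral_kernel_prod_right'
  · fun_prop

theorem lintegral_law_zero (C : Controller Sys S) (𝒜 : Automaton AP S) (y : Sys.X × S)
    {f : Sys.X × S → ENNReal} (hf : Measurable f) :
    ∫⁻ ξ, f (ξ 0) ∂(C.law Lab 𝒜 y) = f y := by
  unfold Controller.law
  rw [Kernel.lintegral_traj (X := fun _ => Sys.X × S) _ (f := fun ξ => f (ξ 0))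
    (hf.comp (measurable_pi_apply 0))]
  simp [Function.updateFinset]

theorem law_ae_zero (C : Controller Sys S) (𝒜 : Automaton AP S) (y : Sys.X × S) :
    ∀ᵐ ξ ∂(C.law Lab 𝒜 y), ξ 0 = y := by
  have hm : MeasurableSet {y' : Sys.X × S | y' ≠ y} := (measurableSet_singleton y).compl
  have h := lintegral_law_zero (Lab := Lab) C 𝒜 y
    (f := {y' | y' ≠ y}.indicator 1) (measurable_one.indicator hm)
  have h2 : (fun ξ : ℕ → Sys.X × S => ({y' | y' ≠ y}.indicator 1 (ξ 0) : ENNReal)) =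
      {ξ | ξ 0 ≠ y}.indicator 1 := by
    ext ξ; simp [Set.indicator]
  have hm0 : MeasurableSet {ξ : ℕ → Sys.X × S | ξ 0 ≠ y} :=
    (measurable_pi_apply (X := fun _ : ℕ => Sys.X × S) 0) hm
  rw [h2, lintegral_indicator_one hm0] at h
  rw [ae_iff]
  simpa using h

/-- The one-step kernel is carried by pairs whose automaton component is updated by `δ`, so the set
`D` of violating transitions has mass zero from every state; the Markov property transfers this to
the trajectory. -/
theorem law_ae_succ (C : Controller Sys S) (𝒜 : Automaton AP S) (y : Sys.X × S) (k : ℕ) :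
    ∀ᵐ ξ ∂(C.law Lab 𝒜 y), (ξ (k + 1)).2 = 𝒜.δ (ξ k).2 (Lab.L (ξ (k + 1)).1) := by
  have hstep := measurable_step (Sys := Sys) Lab 𝒜
  have hD : MeasurableSet {p : (Sys.X × S) × (Sys.X × S) | p.2.2 ≠ 𝒜.δ p.1.2 (Lab.L p.2.1)} := by
    have h1 : Measurable fun p : (Sys.X × S) × (Sys.X × S) => (p.2.2, 𝒜.δ p.1.2 (Lab.L p.2.1)) :=
      (measurable_snd.comp measurable_snd).prodMk
        (measurable_snd.comp (hstep.comp
          (measurable_fst.prodMk (measurable_fst.comp measurable_snd))))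
    exact h1 (MeasurableSet.of_discrete (s := {q : S × S | q.1 ≠ q.2}))
  set D := {p : (Sys.X × S) × (Sys.X × S) | p.2.2 ≠ 𝒜.δ p.1.2 (Lab.L p.2.1)}
  have hg : Measurable fun p : ((i : Finset.Iic k) → Sys.X × S) × (Sys.X × S) =>
      (p.1 ⟨k, Finset.mem_Iic.2 le_rfl⟩, p.2) := by fun_prop
  have hI : Measurable (D.indicator (1 : (Sys.X × S) × (Sys.X × S) → ENNReal)) :=
    measurable_one.indicator hD
  have h := lintegral_law_succ (Lab := Lab) C 𝒜 y k
    (F := fun p => D.indicator 1 (p.1 ⟨k, Finset.mem_Iic.2 le_rfl⟩, p.2)) (hI.comp hg)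
  have h0 : ∀ ξ : ℕ → Sys.X × S, ∫⁻ y', D.indicator 1 (ξ k, y')
      ∂(C.stepKernel Lab 𝒜 k (ξ k)) = (0 : ENNReal) := by
    intro ξ
    rw [lintegral_stepKernel C 𝒜 k (ξ k) (f := fun y' => D.indicator 1 (ξ k, y'))
      (hI.comp measurable_prodMk_left)]
    simp [D]
  have h1 : ∫⁻ ξ, D.indicator 1 (ξ k, ξ (k + 1)) ∂(C.law Lab 𝒜 y) = (0 : ENNReal) := by
    refine h.trans ?_
    simp only [Preorder.frestrictLe_apply, h0, lintegral_zero]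
  rw [lintegral_eq_zero_iff (f := fun ξ : ℕ → Sys.X × S => D.indicator 1 (ξ k, ξ (k + 1)))
    (hI.comp ((measurable_pi_apply k).prodMk (measurable_pi_apply (k + 1))))] at h1
  filter_upwards [h1] with ξ hξ
  by_contra hne
  have : (ξ k, ξ (k + 1)) ∈ D := hne
  simp [this] at hξ

/-- The trajectory starts after the letter `L(x)` has been read, in agreement with `Automaton.run`,
whose value at `0` has already consumed the first letter. -/
theorem law_ae_run (C : Controller Sys S) (𝒜 : Automaton AP S) (x : Sys.X) (s : S) :
    ∀ᵐ ξ ∂(C.law Lab 𝒜 (x, 𝒜.δ s (Lab.L x))), ∀ k,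
      𝒜.run s (fun k => Lab.L (ξ k).1) k = (ξ k).2 := by
  filter_upwards [law_ae_zero C 𝒜 (x, 𝒜.δ s (Lab.L x)),
    ae_all_iff.2 (law_ae_succ C 𝒜 (x, 𝒜.δ s (Lab.L x)))] with ξ h0 h k
  induction k with
  | zero => simp [Automaton.run, h0]
  | succ k ih => rw [Automaton.run, ih, h k]

theorem satProb_eq_reachProb (C : Controller Sys S) {𝒜 : Automaton AP S} {φ : Spec AP} {H : ℕ}
    (h𝒜 : 𝒜.EquivSpec φ H) (x : Sys.X) {s : S} (hs : s ∈ 𝒜.init) :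
    C.satProb Lab 𝒜 φ H x s = C.reachProb Lab 𝒜 H x (𝒜.δ s (Lab.L x)) := by
  refine measureReal_congr ?_
  filter_upwards [law_ae_run C 𝒜 x s] with ξ hξ
  have := h𝒜 s hs fun k => Lab.L (ξ k).1
  simp only [hξ] at this
  exact propext this

open Classical in
/-- The probability to reach the accepting set within `r` further steps, from a given state at
time `k`, as computed by backward recursion. -/
noncomputable def Controller.reachValue (C : Controller Sys S) (Lab : Labeling Sys AP)
    (𝒜 : Automaton AP S) : ℕ → ℕ → Sys.X × S → ENNReal
  | 0, _, y => if y.2 ∈ 𝒜.acc then 1 else 0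
  | r + 1, k, y => if y.2 ∈ 𝒜.acc then 1 else
      ∫⁻ y', C.reachValue Lab 𝒜 r (k + 1) y' ∂(C.stepKernel Lab 𝒜 k y)

omit [Finite AP] [Countable S] in
theorem measurable_reachValue (C : Controller Sys S) (𝒜 : Automaton AP S) (r k : ℕ) :
    Measurable (C.reachValue Lab 𝒜 r k) := by
  induction r generalizing k with
  | zero =>
    exact Measurable.ite (measurableSet_snd_mem_acc 𝒜) measurable_const measurable_const
  | succ r ih =>
    exact Measurable.ite (measurableSet_snd_mem_acc 𝒜) measurable_const
      (ih (k + 1)).lintegral_kernel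

theorem reachValue_le_one (C : Controller Sys S) (𝒜 : Automaton AP S) (r k : ℕ)
    (y : Sys.X × S) : C.reachValue Lab 𝒜 r k y ≤ 1 := by
  induction r generalizing k y with
  | zero => rw [Controller.reachValue]; split_ifs <;> simp
  | succ r ih =>
    rw [Controller.reachValue]
    split_ifs
    · exact le_rfl
    · exact (lintegral_mono fun y' => ih (k + 1) y').trans (by simp)

-- The integrand is the conditional probability, given the history up to `k`, of a visit by time `k
-- + r`. Trading one remaining step for one elapsed step preserves its integral, and at `r = 0` it
-- is an indicator. The strict `j < k` leaves the visit at time `k` to `reachValue`.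
open Classical in
theorem lintegral_law_reachValue (C : Controller Sys S) (𝒜 : Automaton AP S) (y : Sys.X × S)
    (r k : ℕ) :
    ∫⁻ ξ, (if ∃ j < k, (ξ j).2 ∈ 𝒜.acc then 1 else C.reachValue Lab 𝒜 r k (ξ k))
        ∂(C.law Lab 𝒜 y) =
      C.law Lab 𝒜 y {ξ | ∃ j ≤ k + r, (ξ j).2 ∈ 𝒜.acc} := by
  have hacc : ∀ j, MeasurableSet {ξ : ℕ → Sys.X × S | (ξ j).2 ∈ 𝒜.acc} := fun j =>
    (measurable_pi_apply (X := fun _ : ℕ => Sys.X × S) j) (measurableSet_snd_mem_acc 𝒜)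
  induction r generalizing k with
  | zero =>
    have hm : MeasurableSet {ξ : ℕ → Sys.X × S | ∃ j ≤ k, (ξ j).2 ∈ 𝒜.acc} := by
      simp only [Set.ofPred_exists, Set.ofPred_and]
      exact MeasurableSet.iUnion fun j => (MeasurableSet.const _).inter (hacc j)
    rw [add_zero, ← lintegral_indicator_one hm]
    congr with ξ
    simp only [Controller.reachValue, Set.indicator, Set.mem_ofPred_eq, Pi.one_apply]
    by_cases h1 : ∃ j < k, (ξ j).2 ∈ 𝒜.acc
    · have : ∃ j ≤ k, (ξ j).2 ∈ 𝒜.acc := h1.imp fun j hj => ⟨hj.1.le, hj.2⟩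
      simp only [if_pos h1, if_pos this]
    · have : (∃ j ≤ k, (ξ j).2 ∈ 𝒜.acc) ↔ (ξ k).2 ∈ 𝒜.acc := by
        refine ⟨fun ⟨j, hj, hs⟩ => ?_, fun h => ⟨k, le_rfl, h⟩⟩
        rcases hj.lt_or_eq with hj | rfl
        · exact absurd ⟨j, hj, hs⟩ h1
        · exact hs
      simp only [if_neg h1, this]
  | succ r ih =>
    have hset : {ξ : ℕ → Sys.X × S | ∃ j ≤ k + (r + 1), (ξ j).2 ∈ 𝒜.acc} =
        {ξ | ∃ j ≤ (k + 1) + r, (ξ j).2 ∈ 𝒜.acc} := by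
      rw [show k + (r + 1) = (k + 1) + r by omega]
    rw [hset, ← ih (k + 1)]
    have hm : MeasurableSet {p : ((i : Finset.Iic k) → Sys.X × S) × (Sys.X × S) |
        ∃ j, (p.1 j).2 ∈ 𝒜.acc} := by
      simp only [Set.ofPred_exists]
      refine MeasurableSet.iUnion fun j => ?_
      have : Measurable fun p : ((i : Finset.Iic k) → Sys.X × S) × (Sys.X × S) => p.1 j := by
        fun_prop
      exact this (measurableSet_snd_mem_acc 𝒜)
    have key := lintegral_law_succ (Lab := Lab) C 𝒜 y k
      (F := fun p => if ∃ j, (p.1 j).2 ∈ 𝒜.acc then 1 else C.reachValue Lab 𝒜 r (k + 1) p.2)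
      (Measurable.ite hm measurable_const
        ((measurable_reachValue C 𝒜 r (k + 1)).comp measurable_snd))
    have hex : ∀ ξ : ℕ → Sys.X × S, (∃ j : Finset.Iic k,
        (Preorder.frestrictLe (π := fun _ => Sys.X × S) k ξ j).2 ∈ 𝒜.acc) ↔
        ∃ j < k + 1, (ξ j).2 ∈ 𝒜.acc := by
      intro ξ
      constructor
      · rintro ⟨j, hj⟩
        exact ⟨j, Nat.lt_succ_of_le (Finset.mem_Iic.1 j.2), hj⟩
      · rintro ⟨j, hj, h⟩
        exact ⟨⟨j, Finset.mem_Iic.2 (Nat.le_of_lt_succ hj)⟩, h⟩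
    simp only [hex] at key
    rw [key]
    congr with ξ
    by_cases h1 : ∃ j < k, (ξ j).2 ∈ 𝒜.acc
    · have : ∃ j < k + 1, (ξ j).2 ∈ 𝒜.acc := h1.imp fun j hj => ⟨hj.1.trans k.lt_succ_self, hj.2⟩
      simp only [if_pos h1, if_pos this, lintegral_const, measure_univ, mul_one]
    · have : (∃ j < k + 1, (ξ j).2 ∈ 𝒜.acc) ↔ (ξ k).2 ∈ 𝒜.acc := by
        refine ⟨fun ⟨j, hj, hs⟩ => ?_, fun h => ⟨k, k.lt_succ_self, h⟩⟩
        rcases (Nat.le_of_lt_succ hj).lt_or_eq with hj | rfl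
        · exact absurd ⟨j, hj, hs⟩ h1
        · exact hs
      simp only [if_neg h1, this, Controller.reachValue]
      split_ifs <;> simp

theorem reachProb_eq_reachValue (C : Controller Sys S) (𝒜 : Automaton AP S) (H : ℕ) (x : Sys.X)
    (s : S) : C.reachProb Lab 𝒜 H x s = (C.reachValue Lab 𝒜 H 0 (x, s)).toReal := by
  have h := lintegral_law_reachValue (Lab := Lab) C 𝒜 (x, s) H 0
  simp only [not_lt_zero, false_and, exists_false, if_false, zero_add] at h
  rw [lintegral_law_zero C 𝒜 (x, s) (measurable_reachValue C 𝒜 H 0)] at h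
  rw [h]
  rfl

end Trajectory

/-! ### Comparison of one-step laws. -/

section Comparison

/-- The setwise bounds say `ν ≤ ν' + ρ`, where `ρ` has density `c l` with respect to `μ`.
Integrating `f ≤ 1` costs at most the total mass of `ρ`; no measurability of `f` enters. -/
theorem lintegral_le_lintegral_add_of_real_le {X : Type*} [MeasurableSpace X]
    {ν ν' μ : Measure X} [IsFiniteMeasure ν] [IsFiniteMeasure ν'] {l : X → ℝ} (hl0 : 0 ≤ l)
    (hl : Integrable l μ) {c : ℝ} (hc : 0 ≤ c)
    (h : ∀ A, MeasurableSet A → ν.real A - ν'.real A ≤ c * ∫ y in A, l y ∂μ)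
    {f : X → ENNReal} (hf : ∀ x, f x ≤ 1) :
    ∫⁻ x, f x ∂ν ≤ ∫⁻ x, f x ∂ν' + ENNReal.ofReal (c * ∫ y, l y ∂μ) := by
  set ρ := μ.withDensity fun y => ENNReal.ofReal (c * l y) with hρ
  have hρA : ∀ A, MeasurableSet A → ρ A = ENNReal.ofReal (c * ∫ y in A, l y ∂μ) := by
    intro A hA
    rw [hρ, withDensity_apply _ hA, ← integral_const_mul,
      ofReal_integral_eq_lintegral_ofReal (hl.const_mul c).integrableOn
        (Filter.Eventually.of_forall fun y => mul_nonneg hc (hl0 y))]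
  have hle : ν ≤ ν' + ρ := by
    refine Measure.le_iff.2 fun A hA => ?_
    rw [Measure.add_apply, hρA A hA, ← ofReal_measureReal (μ := ν), ← ofReal_measureReal (μ := ν'),
      ← ENNReal.ofReal_add measureReal_nonneg
        (mul_nonneg hc (setIntegral_nonneg hA fun y _ => hl0 y))]
    exact ENNReal.ofReal_le_ofReal (by linarith [h A hA])
  calc ∫⁻ x, f x ∂ν ≤ ∫⁻ x, f x ∂(ν' + ρ) := lintegral_mono' hle le_rfl
    _ = ∫⁻ x, f x ∂ν' + ∫⁻ x, f x ∂ρ := lintegral_add_measure _ _ _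
    _ ≤ ∫⁻ x, f x ∂ν' + ∫⁻ _, 1 ∂ρ := by gcongr with x; exact hf x
    _ = _ := by rw [lintegral_one, hρA _ MeasurableSet.univ, setIntegral_univ]

variable {n m N M : ℕ} {Sys : RobotSystem n m} {AP : Type} {Lab : Labeling Sys AP}
  {Gr : Grid Sys Lab N M} {μ : Measure Sys.X} {l b : Fin N → Sys.X → ℝ}

/-- Pass through `(x', u)`: move the state with the action fixed, then change the action at `x'`. -/
theorem lintegral_kernel_le (hl : LipschitzInState Gr μ l) (hb : LipschitzInAction Gr μ b)
    {i : Fin N} {x x' : Sys.X} (hx : x.1 ∈ Gr.cell i) (hx' : x'.1 ∈ Gr.cell i) (u u' : Sys.U)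
    {f : Sys.X → ENNReal} (hf : ∀ x, f x ≤ 1) :
    ∫⁻ y, f y ∂(Sys.t (x, u)) ≤ ∫⁻ y, f y ∂(Sys.t (x', u')) +
      ENNReal.ofReal (‖x.1 - x'.1‖ * (∫ y, l i y ∂μ) + ‖u.1 - u'.1‖ * ∫ y, b i y ∂μ) := by
  have := Sys.markov
  obtain ⟨hl0, hli, hlA⟩ := hl i
  obtain ⟨hb0, hbi, hbA⟩ := hb i
  have h1 := lintegral_le_lintegral_add_of_real_le hl0 hli (norm_nonneg (x.1 - x'.1))
    (fun A hA => (le_abs_self _).trans (hlA x' x hx' hx u A hA)) hf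
  have h2 := lintegral_le_lintegral_add_of_real_le hb0 hbi (norm_nonneg (u.1 - u'.1))
    (fun A hA => (le_abs_self _).trans (hbA x' hx' u' u A hA)) hf
  rw [ENNReal.ofReal_add (mul_nonneg (norm_nonneg _) (integral_nonneg hl0))
    (mul_nonneg (norm_nonneg _) (integral_nonneg hb0)), add_comm (ENNReal.ofReal _), ← add_assoc]
  exact h1.trans (by gcongr)

end Comparison

/-! ### Distances between states and between affine control actions. -/

section Geometry

variable {n m : ℕ}

theorem norm_ctrlEval_sub_le_opNorm (K : Params m n) (x x' : Vec n) :
    ‖ctrlEval K x - ctrlEval K x'‖ ≤ opNorm K * ‖x - x'‖ := by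
  -- The offsets cancel in the difference, so the last coordinate is `0`; this lets the norm of the
  -- full matrix, offset column included, bound the variation of the affine map.
  set w : Vec (n + 1) := WithLp.toLp 2 (Fin.snoc (α := fun _ => ℝ) (fun j => x j - x' j) 0) with hw
  have h1 : ctrlEval K x - ctrlEval K x' =
      LinearMap.toContinuousLinearMap (Matrix.toEuclideanLin K) w := by
    ext i
    simp [ctrlEval, hw, Matrix.toEuclideanLin, Matrix.mulVec, dotProduct, Fin.sum_univ_castSucc,
      mul_sub, Finset.sum_sub_distrib]
  have h2 : ‖w‖ = ‖x - x'‖ := by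
    simp [hw, EuclideanSpace.norm_eq, Fin.sum_univ_castSucc]
  rw [h1, ← h2]
  exact ContinuousLinearMap.le_opNorm _ _

/-- Cauchy–Schwarz in each of the `m` rows, against `x` extended by the coordinate `1` that
multiplies the offset. -/
theorem norm_ctrlEval_sub_le_of_entries {K K' : Params m n} {r : ℝ} (hr : 0 ≤ r)
    (hK : ∀ i j, |K i j - K' i j| ≤ r) (x : Vec n) :
    ‖ctrlEval K x - ctrlEval K' x‖ ≤ √(m * (n + 1)) * (r * √(‖x‖ ^ 2 + 1)) := by
  set w : Fin (n + 1) → ℝ := Fin.snoc (α := fun _ => ℝ) (fun j => x j) 1 with hw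
  have hw2 : ∑ j, w j ^ 2 = ‖x‖ ^ 2 + 1 := by
    simp [hw, Fin.sum_univ_castSucc, EuclideanSpace.real_norm_sq_eq]
  have hcomp : ∀ i, (ctrlEval K x - ctrlEval K' x) i = ∑ j, (K i j - K' i j) * w j := by
    intro i
    simp [ctrlEval, hw, Fin.sum_univ_castSucc, sub_mul, Finset.sum_sub_distrib]
  have hrow : ∀ i, (ctrlEval K x - ctrlEval K' x) i ^ 2 ≤ (n + 1) * r ^ 2 * (‖x‖ ^ 2 + 1) := by
    intro i
    rw [hcomp, ← hw2]
    refine (Finset.sum_mul_sq_le_sq_mul_sq _ _ _).trans ?_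
    refine mul_le_mul_of_nonneg_right ?_ (Finset.sum_nonneg fun j _ => sq_nonneg _)
    calc ∑ j, (K i j - K' i j) ^ 2 ≤ ∑ _j : Fin (n + 1), r ^ 2 :=
          Finset.sum_le_sum fun j _ => sq_le_sq' (abs_le.1 (hK i j)).1 (abs_le.1 (hK i j)).2
      _ = (n + 1) * r ^ 2 := by simp
  rw [EuclideanSpace.norm_eq]
  have hsq : ∑ i, ‖(ctrlEval K x - ctrlEval K' x) i‖ ^ 2 ≤
      (√(m * (n + 1)) * (r * √(‖x‖ ^ 2 + 1))) ^ 2 := by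
    rw [mul_pow, mul_pow, Real.sq_sqrt (by positivity), Real.sq_sqrt (by positivity)]
    calc ∑ i, ‖(ctrlEval K x - ctrlEval K' x) i‖ ^ 2
        ≤ ∑ _i : Fin m, (n + 1) * r ^ 2 * (‖x‖ ^ 2 + 1) :=
          Finset.sum_le_sum fun i _ => by rw [Real.norm_eq_abs, sq_abs]; exact hrow i
      _ = _ := by simp; ring
  exact Real.sqrt_le_iff.2 ⟨by positivity, hsq⟩

variable {N M : ℕ} {Sys : RobotSystem n m} {AP : Type} {Lab : Labeling Sys AP}
  {Gr : Grid Sys Lab N M}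

theorem norm_ctrlEval_sub_kctr_le {ηP LX : ℝ} (hηP : ∀ j, 2 * Gr.krad j ≤ ηP)
    (hLX : ∀ x ∈ Sys.X, ‖x‖ ≤ LX) (hLX1 : 1 ≤ LX) {j : Fin M} {K : Params m n}
    (hK : K ∈ Gr.part j) {x : Vec n} (hx : x ∈ Sys.X) :
    ‖ctrlEval K x - ctrlEval (Gr.kctr j) x‖ ≤ √(m * (n + 1)) * LX * ηP := by
  obtain ⟨hr, -, hsub⟩ := Gr.part_ball j
  refine (norm_ctrlEval_sub_le_of_entries hr.le (hsub hK) x).trans ?_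
  rw [mul_assoc]
  refine mul_le_mul_of_nonneg_left ?_ (Real.sqrt_nonneg _)
  -- Since `LX ≥ 1` absorbs the offset coordinate, the factor `2` suffices; it is then absorbed
  -- because `ηP` bounds twice the radius.
  have hs : √(‖x‖ ^ 2 + 1) ≤ 2 * LX := by
    refine Real.sqrt_le_iff.2 ⟨by linarith, ?_⟩
    nlinarith [hLX x hx, norm_nonneg x]
  nlinarith [mul_le_mul_of_nonneg_left hs hr.le, mul_le_mul_of_nonneg_left (hηP j)
    (zero_le_one.trans hLX1)]

theorem Grid.norm_sub_le_of_mem_cell {ηq LX : ℝ} (hηq : ∀ i, Metric.diam (Gr.cell i) ≤ ηq)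
    (hLX : ∀ x ∈ Sys.X, ‖x‖ ≤ LX) {i : Fin N} {x x' : Vec n} (hx : x ∈ Gr.cell i)
    (hx' : x' ∈ Gr.cell i) : ‖x - x'‖ ≤ ηq := by
  -- Without boundedness `Metric.diam` could be the default value `0` and bound nothing.
  have hbd : Bornology.IsBounded (Gr.cell i) :=
    isBounded_iff_forall_norm_le.2 ⟨LX, fun y hy => hLX y (Gr.cell_subset i hy)⟩
  rw [← dist_eq_norm]
  exact (Metric.dist_le_diam_of_mem hbd hx hx').trans (hηq i)

end Geometry

/-! ### The symbolic Bellman recursion and its comparison with the closed loop. -/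

section Symbolic

variable {n m N M : ℕ} {Sys : RobotSystem n m} {AP S : Type} {Lab : Labeling Sys AP}

/-- A point of the cell `q` that `abs` sends elsewhere lies in an overlap of two cells, which the
kernel does not charge. -/
theorem Grid.measure_abs_eq (Gr : Grid Sys Lab N M) (y : Sys.X × Sys.U) (q : Fin N) :
    Sys.t y (Gr.abs ⁻¹' {q}) = Sys.t y {x' | x'.1 ∈ Gr.cell q} := by
  refine le_antisymm (measure_mono ?_) ?_
  · rintro x rfl
    exact Gr.abs_mem x
  · have hsub : {x' : Sys.X | x'.1 ∈ Gr.cell q} ⊆ Gr.abs ⁻¹' {q} ∪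
        ⋃ i : {i // i ≠ q}, {x' : Sys.X | x'.1 ∈ Gr.cell i.1 ∩ Gr.cell q} := by
      intro x hx
      by_cases h : Gr.abs x = q
      · exact Or.inl h
      · exact Or.inr (Set.mem_iUnion.2 ⟨⟨Gr.abs x, h⟩, Gr.abs_mem x, hx⟩)
    refine (measure_mono hsub).trans ((measure_union_le _ _).trans ?_)
    rw [measure_iUnion_null fun i : {i // i ≠ q} => Gr.cell_null i q i.2 y,
      add_zero]

variable [Fintype S]

/-- The automaton is deterministic: each `q'` admits exactly one successor automaton state. -/
theorem Grid.sum_prodT (Gr : Grid Sys Lab N M) (𝒜 : Automaton AP S) (V : Fin N × S → ℝ)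
    (q : Fin N) (s : S) (j : Fin M) :
    ∑ y', V y' * Gr.prodT 𝒜 y' (q, s) j =
      ∑ q', V (q', 𝒜.δ s (Gr.absL q')) * Gr.absT q' q j := by
  classical
  rw [Fintype.sum_prod_type]
  refine Finset.sum_congr rfl fun q' _ => ?_
  simp [Grid.prodT]

/-- The symbolic Bellman operator integrates against the kernel at the centers. -/
theorem Grid.lintegral_center (Gr : Grid Sys Lab N M) (𝒜 : Automaton AP S) {V : Fin N × S → ℝ}
    (hV : 0 ≤ V) {q : Fin N} {s : S} (hs : s ∉ 𝒜.acc) (j : Fin M) :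
    ∫⁻ x', ENNReal.ofReal (V (Gr.abs x', 𝒜.δ s (Lab.L x')))
        ∂(Sys.t (Gr.center q, Gr.centerAction q j)) =
      ENNReal.ofReal (Gr.absQ 𝒜 V (q, s) j) := by
  have := Sys.markov
  have h1 : ∫⁻ x', ENNReal.ofReal (V (Gr.abs x', 𝒜.δ s (Lab.L x')))
        ∂(Sys.t (Gr.center q, Gr.centerAction q j)) =
      ∫⁻ q', ENNReal.ofReal (V (q', 𝒜.δ s (Gr.absL q')))
        ∂((Sys.t (Gr.center q, Gr.centerAction q j)).map Gr.abs) := by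
    rw [lintegral_map (measurable_of_finite _) Gr.abs_meas]
    simp only [Gr.absL_eq]
  have hT : ∀ q', 0 ≤ Gr.absT q' q j := fun q' => measureReal_nonneg
  rw [h1, lintegral_fintype, Grid.absQ, if_neg hs, Gr.sum_prodT,
    ENNReal.ofReal_sum_of_nonneg fun q' _ => mul_nonneg (hV _) (hT q')]
  refine Finset.sum_congr rfl fun q' _ => ?_
  rw [Measure.map_apply Gr.abs_meas (measurableSet_singleton q'), Gr.measure_abs_eq,
    ENNReal.ofReal_mul (hV _), Grid.absT, ofReal_measureReal]

theorem Grid.absQ_nonneg (Gr : Grid Sys Lab N M) (𝒜 : Automaton AP S) {V : Fin N × S → ℝ}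
    (hV : 0 ≤ V) (y : Fin N × S) (j : Fin M) : 0 ≤ Gr.absQ 𝒜 V y j := by
  rw [Grid.absQ]
  split_ifs
  · exact zero_le_one
  · rw [Gr.sum_prodT]
    exact Finset.sum_nonneg fun q' _ => mul_nonneg (hV _) measureReal_nonneg

theorem Grid.absV_nonneg (Gr : Grid Sys Lab N M) (𝒜 : Automaton AP S) (r : ℕ) :
    0 ≤ Gr.absV 𝒜 r := by
  intro y
  induction r generalizing y with
  | zero => simp only [Grid.absV, Pi.zero_apply]; split_ifs <;> norm_num
  | succ r ih => exact Real.iSup_nonneg fun j => Gr.absQ_nonneg 𝒜 ih y j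

/-- A partition must exist, as a real supremum over an empty type is `0`, not `1`. -/
theorem Grid.absV_succ_of_mem_acc (Gr : Grid Sys Lab N M) (𝒜 : Automaton AP S) [Nonempty (Fin M)]
    (r : ℕ) {y : Fin N × S} (hy : y.2 ∈ 𝒜.acc) : Gr.absV 𝒜 (r + 1) y = 1 := by
  simp [Grid.absV, Grid.absQ, hy]

theorem Grid.absQ_le_absV_succ (Gr : Grid Sys Lab N M) (𝒜 : Automaton AP S) (r : ℕ)
    (y : Fin N × S) (j : Fin M) : Gr.absQ 𝒜 (Gr.absV 𝒜 r) y j ≤ Gr.absV 𝒜 (r + 1) y :=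
  le_ciSup (f := fun j => Gr.absQ 𝒜 (Gr.absV 𝒜 r) y j) (Set.finite_range _).bddAbove j

variable [Finite AP] [MeasurableSpace S] [DiscreteMeasurableSpace S]

/-- If every one-step law under `C` is within `Δ` of a symbolic transition law, then `C` reaches
the accepting set with at most the optimal probability of the symbolic model, up to `Δ` per step. -/
theorem reachValue_le_absV_add {Gr : Grid Sys Lab N M} (C : Controller Sys S) (𝒜 : Automaton AP S)
    {Δ : ℝ} (hΔ : 0 ≤ Δ)
    (hstep : ∀ k (y : Sys.X × S), ∃ j : Fin M, ∀ f : Sys.X → ENNReal, (∀ x, f x ≤ 1) →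
      ∫⁻ x, f x ∂(Sys.t (y.1, C.act k y)) ≤
        ∫⁻ x, f x ∂(Sys.t (Gr.center (Gr.abs y.1), Gr.centerAction (Gr.abs y.1) j)) +
          ENNReal.ofReal Δ) (r k : ℕ) (y : Sys.X × S) :
    C.reachValue Lab 𝒜 r k y ≤
      ENNReal.ofReal (Gr.absV 𝒜 r (Gr.abs y.1, y.2)) + ENNReal.ofReal (r * Δ) := by
  have := Sys.markov
  induction r generalizing k y with
  | zero => simp only [Controller.reachValue, Grid.absV]; split_ifs <;> simp
  | succ r ih =>
    obtain ⟨j, hj⟩ := hstep k y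
    have : Nonempty (Fin M) := ⟨j⟩
    by_cases hs : y.2 ∈ 𝒜.acc
    · simp [Controller.reachValue, hs, Gr.absV_succ_of_mem_acc]
    rw [Controller.reachValue, if_neg hs, lintegral_stepKernel C 𝒜 k y
      (measurable_reachValue C 𝒜 r (k + 1))]
    -- Replacing the true law by the symbolic one costs `Δ` once; the induction hypothesis under
    -- that probability law then adds `r * Δ`.
    refine (hj _ fun x => reachValue_le_one C 𝒜 r (k + 1) _).trans ?_
    calc _ ≤ ∫⁻ x', (ENNReal.ofReal (Gr.absV 𝒜 r (Gr.abs x', 𝒜.δ y.2 (Lab.L x'))) +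
            ENNReal.ofReal (r * Δ))
              ∂(Sys.t (Gr.center (Gr.abs y.1), Gr.centerAction (Gr.abs y.1) j)) +
          ENNReal.ofReal Δ := by
          gcongr with x'
          exact ih (k + 1) (x', _)
      _ = ENNReal.ofReal (Gr.absQ 𝒜 (Gr.absV 𝒜 r) (Gr.abs y.1, y.2) j) +
            ENNReal.ofReal ((r + 1 : ℕ) * Δ) := by
          rw [lintegral_add_right _ measurable_const, Gr.lintegral_center 𝒜 (Gr.absV_nonneg 𝒜 r) hs,
            lintegral_const, measure_univ, mul_one, add_assoc,
            ← ENNReal.ofReal_add (by positivity) hΔ]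
          push_cast
          ring_nf
      _ ≤ _ := by
          gcongr
          exact Gr.absQ_le_absV_succ 𝒜 r _ j

/-- If every one-step law under `C` is within `Δ` of the symbolic transition law selected by `Γ`,
then `C` reaches the accepting set with at least the optimal probability of the symbolic model, up
to `Δ` per step. -/
theorem absV_le_reachValue_add {Gr : Grid Sys Lab N M} (C : Controller Sys S) (𝒜 : Automaton AP S)
    {H : ℕ} {Γ : ℕ → Fin N → S → Fin M} (hΓ : Gr.IsSelection 𝒜 H Γ) {Δ : ℝ} (hΔ : 0 ≤ Δ)
    (hstep : ∀ k (y : Sys.X × S), ∀ f : Sys.X → ENNReal, (∀ x, f x ≤ 1) →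
      ∫⁻ x, f x ∂(Sys.t (Gr.center (Gr.abs y.1),
          Gr.centerAction (Gr.abs y.1) (Γ k (Gr.abs y.1) y.2))) ≤
        ∫⁻ x, f x ∂(Sys.t (y.1, C.act k y)) + ENNReal.ofReal Δ) (r k : ℕ) (hk : k + r = H)
    (y : Sys.X × S) :
    ENNReal.ofReal (Gr.absV 𝒜 r (Gr.abs y.1, y.2)) ≤
      C.reachValue Lab 𝒜 r k y + ENNReal.ofReal (r * Δ) := by
  have := Sys.markov
  induction r generalizing k y with
  | zero => simp only [Controller.reachValue, Grid.absV]; split_ifs <;> simp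
  | succ r ih =>
    set j := Γ k (Gr.abs y.1) y.2
    have : Nonempty (Fin M) := ⟨j⟩
    by_cases hs : y.2 ∈ 𝒜.acc
    · simp [Controller.reachValue, hs, Gr.absV_succ_of_mem_acc]
    -- At time `k` the selection maximizes the action value built on `H - (k + 1)` remaining steps,
    -- which is the value function of the induction hypothesis.
    have hr : H - (k + 1) = r := by omega
    have hmax : Gr.absV 𝒜 (r + 1) (Gr.abs y.1, y.2) ≤
        Gr.absQ 𝒜 (Gr.absV 𝒜 r) (Gr.abs y.1, y.2) j :=
      ciSup_le fun j' => by
        have := hΓ k (by omega) (Gr.abs y.1) y.2 j'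
        rwa [hr] at this
    refine (ENNReal.ofReal_le_ofReal hmax).trans ?_
    rw [← Gr.lintegral_center 𝒜 (Gr.absV_nonneg 𝒜 r) hs, Controller.reachValue, if_neg hs,
      lintegral_stepKernel C 𝒜 k y (measurable_reachValue C 𝒜 r (k + 1))]
    -- Here the induction hypothesis comes first, under the symbolic law, so that the law is
    -- exchanged only against `reachValue`, which is at most `1`.
    calc _ ≤ ∫⁻ x', (C.reachValue Lab 𝒜 r (k + 1) (x', 𝒜.δ y.2 (Lab.L x')) +
            ENNReal.ofReal (r * Δ))
              ∂(Sys.t (Gr.center (Gr.abs y.1), Gr.centerAction (Gr.abs y.1) j)) :=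
          lintegral_mono fun x' => ih (k + 1) (by omega) (x', _)
      _ = ∫⁻ x', C.reachValue Lab 𝒜 r (k + 1) (x', 𝒜.δ y.2 (Lab.L x'))
              ∂(Sys.t (Gr.center (Gr.abs y.1), Gr.centerAction (Gr.abs y.1) j)) +
            ENNReal.ofReal (r * Δ) := by
          rw [lintegral_add_right _ measurable_const, lintegral_const, measure_univ, mul_one]
      _ ≤ (∫⁻ x', C.reachValue Lab 𝒜 r (k + 1) (x', 𝒜.δ y.2 (Lab.L x'))
              ∂(Sys.t (y.1, C.act k y)) + ENNReal.ofReal Δ) + ENNReal.ofReal (r * Δ) := by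
          gcongr
          exact hstep k y _ fun x => reachValue_le_one C 𝒜 r (k + 1) _
      _ = _ := by
          rw [add_assoc, ← ENNReal.ofReal_add hΔ (by positivity)]
          push_cast
          ring_nf

end Symbolic

/-! ### One-step errors of the two controllers and the resulting gap. -/

section Bounds

variable {n m N M : ℕ} {Sys : RobotSystem n m} {AP S : Type} {Lab : Labeling Sys AP}
  {Gr : Grid Sys Lab N M} {μ : Measure Sys.X} {l b : Fin N → Sys.X → ℝ} {ηq ηP LX : ℝ}

theorem ofReal_kernel_dist_le (hl : LipschitzInState Gr μ l) (hb : LipschitzInAction Gr μ b)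
    {i : Fin N} {d e a Δ : ℝ} (hd : d ≤ ηq) (he : e ≤ a)
    (hΔ : (∫ y, l i y ∂μ) * ηq + (∫ y, b i y ∂μ) * a ≤ Δ) :
    ENNReal.ofReal (d * (∫ y, l i y ∂μ) + e * ∫ y, b i y ∂μ) ≤ ENNReal.ofReal Δ := by
  refine ENNReal.ofReal_le_ofReal (le_trans ?_ hΔ)
  have h1 := mul_le_mul_of_nonneg_left hd (integral_nonneg (μ := μ) (hl i).1)
  have h2 := mul_le_mul_of_nonneg_left he (integral_nonneg (μ := μ) (hb i).1)
  linarith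

theorem planner_admissible [MeasurableSpace S] [Countable S] [DiscreteMeasurableSpace S]
    (𝔏 : Library Gr) (Γ : ℕ → Fin N → S → Fin M) : (planner 𝔏 Γ).Admissible Gr := by
  intro k y
  obtain ⟨K, hK, h⟩ := 𝔏.eval_eq (Gr.abs y.1) (Γ k (Gr.abs y.1) y.2) (Gr.abs_mem y.1)
  exact ⟨K, Gr.part_subset _ hK, h⟩

/-- Move from `x` to the center `z` by the Lipschitz constant of the network; at `z` the network
equals some `K(z)` with `K` in the partition, hence is close to `κ(z)`. -/
theorem norm_net_sub_centerAction_le (hηq : ∀ i, Metric.diam (Gr.cell i) ≤ ηq)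
    (hηP : ∀ j, 2 * Gr.krad j ≤ ηP) (hLX : ∀ x ∈ Sys.X, ‖x‖ ≤ LX) (hLX1 : 1 ≤ LX)
    (𝔏 : Library Gr) {Lnet : Fin N → ℝ≥0}
    (hLnet : ∀ i j, LipschitzOnWith (Lnet i) (𝔏.net i j).eval (Gr.cell i)) {i : Fin N} (j : Fin M)
    {x : Vec n} (hx : x ∈ Gr.cell i) :
    ‖(𝔏.net i j).eval x - (Gr.centerAction i j).1‖ ≤
      Lnet i * ηq + √(m * (n + 1)) * LX * ηP := by
  have hz := Gr.ctr_mem_cell i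
  obtain ⟨K, hK, hKz⟩ := 𝔏.eval_eq i j hz
  have h1 : ‖(𝔏.net i j).eval x - (𝔏.net i j).eval (Gr.ctr i)‖ ≤ Lnet i * ηq :=
    ((hLnet i j).norm_sub_le hx hz).trans (mul_le_mul_of_nonneg_left
      (Gr.norm_sub_le_of_mem_cell hηq hLX hx hz) (Lnet i).2)
  have h2 := norm_ctrlEval_sub_kctr_le hηP hLX hLX1 hK (Gr.cell_subset i hz)
  rw [← hKz] at h2
  exact (norm_sub_le_norm_sub_add_norm_sub _ _ _).trans (add_le_add h1 h2)

/-- Move from `x` to the center with `K` fixed, then replace `K` by the center of its partition. -/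
theorem norm_ctrlEval_sub_centerAction_le (hηq : ∀ i, Metric.diam (Gr.cell i) ≤ ηq)
    (hηP : ∀ j, 2 * Gr.krad j ≤ ηP) (hLX : ∀ x ∈ Sys.X, ‖x‖ ≤ LX) (hLX1 : 1 ≤ LX)
    {LP : ℝ} (hLP : ∀ K ∈ Gr.ctrl, opNorm K ≤ LP) {i : Fin N} {j : Fin M} {K : Params m n}
    (hK : K ∈ Gr.part j) {x : Vec n} (hx : x ∈ Gr.cell i) :
    ‖ctrlEval K x - (Gr.centerAction i j).1‖ ≤ LP * ηq + √(m * (n + 1)) * LX * ηP := by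
  have hz := Gr.ctr_mem_cell i
  have hKP := hLP K (Gr.part_subset j hK)
  have h0 : 0 ≤ opNorm K := norm_nonneg _
  have h1 : ‖ctrlEval K x - ctrlEval K (Gr.ctr i)‖ ≤ LP * ηq :=
    (norm_ctrlEval_sub_le_opNorm K x _).trans
      (mul_le_mul hKP (Gr.norm_sub_le_of_mem_cell hηq hLX hx hz) (norm_nonneg _) (h0.trans hKP))
  have h2 := norm_ctrlEval_sub_kctr_le hηP hLX hLX1 hK (Gr.cell_subset i hz)
  exact (norm_sub_le_norm_sub_add_norm_sub _ _ _).trans (add_le_add h1 h2)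

/-- The gap between the probabilities of reaching the accepting set under the planner and under an
admissible controller that performs at least as well. -/
theorem abs_reachProb_planner_sub_le [Finite AP] [Fintype S] [MeasurableSpace S]
    [DiscreteMeasurableSpace S] (hηq : ∀ i, Metric.diam (Gr.cell i) ≤ ηq)
    (hηP : ∀ j, 2 * Gr.krad j ≤ ηP) {H : ℕ} {𝒜 : Automaton AP S} (𝔏 : Library Gr)
    {Γ : ℕ → Fin N → S → Fin M} (hΓ : Gr.IsSelection 𝒜 H Γ)
    (hl : LipschitzInState Gr μ l) (hb : LipschitzInAction Gr μ b) {Lnet : Fin N → ℝ≥0}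
    (hLnet : ∀ i j, LipschitzOnWith (Lnet i) (𝔏.net i j).eval (Gr.cell i))
    (hLX : ∀ x ∈ Sys.X, ‖x‖ ≤ LX) (hLX1 : 1 ≤ LX) {LP : ℝ} (hLP : ∀ K ∈ Gr.ctrl, opNorm K ≤ LP)
    {C : Controller Sys S} (hC : C.Admissible Gr) (x : Sys.X) (s : S)
    (hle : (planner 𝔏 Γ).reachProb Lab 𝒜 H x s ≤ C.reachProb Lab 𝒜 H x s) :
    |(planner 𝔏 Γ).reachProb Lab 𝒜 H x s - C.reachProb Lab 𝒜 H x s| ≤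
      H * Fintype.card S *
        (deltaNN n m (fun i => ∫ y, l i y ∂μ) (fun i => ∫ y, b i y ∂μ) Lnet LX ηq ηP +
          deltaStar n m (fun i => ∫ y, l i y ∂μ) (fun i => ∫ y, b i y ∂μ) LP LX ηq ηP) := by
  set ΔN := deltaNN n m (fun i => ∫ y, l i y ∂μ) (fun i => ∫ y, b i y ∂μ) Lnet LX ηq ηP
  set ΔS := deltaStar n m (fun i => ∫ y, l i y ∂μ) (fun i => ∫ y, b i y ∂μ) LP LX ηq ηP
  have hΛ0 : ∀ i, 0 ≤ ∫ y, l i y ∂μ := fun i => integral_nonneg (hl i).1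
  have hB0 : ∀ i, 0 ≤ ∫ y, b i y ∂μ := fun i => integral_nonneg (hb i).1
  have hηq0 : 0 ≤ ηq := Metric.diam_nonneg.trans (hηq (Gr.abs x))
  have hηP0 : 0 ≤ ηP := by
    have h1 := (Gr.part_ball (Γ 0 (Gr.abs x) s)).1
    linarith [hηP (Γ 0 (Gr.abs x) s)]
  have hLP0 : 0 ≤ LP := by
    obtain ⟨K, hK, -⟩ := hC 0 (x, s)
    exact (norm_nonneg _).trans (hLP K hK)
  have hLX0 : 0 ≤ LX := zero_le_one.trans hLX1
  have hc0 : 0 ≤ √(m * (n + 1)) * LX * ηP := by positivity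
  have hNi : ∀ i, (∫ y, l i y ∂μ) * ηq +
      (∫ y, b i y ∂μ) * (Lnet i * ηq + √(m * (n + 1)) * LX * ηP) ≤ ΔN := fun i => by
    refine le_trans (le_of_eq ?_) (le_ciSup (Set.finite_range _).bddAbove i)
    ring
  have hSi : ∀ i, (∫ y, l i y ∂μ) * ηq +
      (∫ y, b i y ∂μ) * (LP * ηq + √(m * (n + 1)) * LX * ηP) ≤ ΔS := fun i => by
    refine le_trans ?_ (le_ciSup (Set.finite_range _).bddAbove i)
    -- Only one of the two partition terms in `Δ*` is needed; the other is dropped as nonnegative.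
    have := mul_nonneg (hB0 i) hc0
    linarith
  have hΔN0 : 0 ≤ ΔN := by
    refine le_trans ?_ (hNi (Gr.abs x))
    have := hΛ0 (Gr.abs x)
    have := hB0 (Gr.abs x)
    positivity
  have hΔS0 : 0 ≤ ΔS := by
    refine le_trans ?_ (hSi (Gr.abs x))
    have := hΛ0 (Gr.abs x)
    have := hB0 (Gr.abs x)
    positivity
  have hup := reachValue_le_absV_add C 𝒜 hΔS0 (fun k y => by
    obtain ⟨K, hK, hact⟩ := hC k y
    rw [← Gr.part_cover] at hK
    obtain ⟨j, hj⟩ := Set.mem_iUnion.1 hK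
    -- The symbolic action is the partition containing the parameters used at this time and state,
    -- so it may vary along the trajectory.
    refine ⟨j, fun f hf => ?_⟩
    have hx := Gr.abs_mem y.1
    have hz := Gr.ctr_mem_cell (Gr.abs y.1)
    have hu := norm_ctrlEval_sub_centerAction_le hηq hηP hLX hLX1 hLP hj hx
    rw [← hact] at hu
    refine (lintegral_kernel_le hl hb hx (x' := Gr.center _) hz _ (Gr.centerAction _ j) hf).trans
      (add_le_add le_rfl ?_)
    exact ofReal_kernel_dist_le hl hb (Gr.norm_sub_le_of_mem_cell hηq hLX hx hz) hu (hSi _))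
      H 0 (x, s)
  have hlow := absV_le_reachValue_add (planner 𝔏 Γ) 𝒜 hΓ hΔN0 (fun k y f hf => by
    have hx := Gr.abs_mem y.1
    have hz := Gr.ctr_mem_cell (Gr.abs y.1)
    have hu := norm_net_sub_centerAction_le hηq hηP hLX hLX1 𝔏 hLnet (Γ k (Gr.abs y.1) y.2) hx
    rw [norm_sub_rev] at hu
    refine (lintegral_kernel_le hl hb (x := Gr.center _) hz hx _ ((planner 𝔏 Γ).act k y) hf).trans
      (add_le_add le_rfl ?_)
    exact ofReal_kernel_dist_le hl hb (Gr.norm_sub_le_of_mem_cell hηq hLX hz hx) hu (hNi _)) H 0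
      (zero_add H) (x, s)
  -- The symbolic optimum is the common middle term and drops out.
  have hchain := hup.trans (add_le_add hlow le_rfl)
  rw [add_assoc, ← ENNReal.ofReal_add (by positivity) (by positivity)] at hchain
  have hreal := ENNReal.toReal_mono (ENNReal.add_ne_top.2
    ⟨((reachValue_le_one (planner 𝔏 Γ) 𝒜 H 0 (x, s)).trans_lt ENNReal.one_lt_top).ne,
      ENNReal.ofReal_ne_top⟩) hchain
  rw [ENNReal.toReal_add
    ((reachValue_le_one (planner 𝔏 Γ) 𝒜 H 0 (x, s)).trans_lt ENNReal.one_lt_top).ne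
    ENNReal.ofReal_ne_top, ENNReal.toReal_ofReal (by positivity), ← reachProb_eq_reachValue,
    ← reachProb_eq_reachValue] at hreal
  have hcard : (1 : ℝ) ≤ Fintype.card S := by
    exact_mod_cast Fintype.card_pos_iff.2 ⟨s⟩
  have hZ : H * (ΔN + ΔS) ≤ H * Fintype.card S * (ΔN + ΔS) := by
    rw [mul_right_comm]
    exact le_mul_of_one_le_right (by positivity) hcard
  rw [abs_sub_comm, abs_of_nonneg (sub_nonneg.2 hle)]
  linarith

end Bounds

end Neurosym

theorem theorem3 {n m N M : ℕ} {AP S : Type} [Finite AP] [Fintype S] [MeasurableSpace S]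
    [DiscreteMeasurableSpace S]
    -- the robotic system with its labels, the partitions with their grid sizes
    (Sys : RobotSystem n m) (Lab : Labeling Sys AP) (Gr : Grid Sys Lab N M)
    (ηq ηP : ℝ) (hηq : ∀ i, Metric.diam (Gr.cell i) ≤ ηq) (hηP : ∀ j, 2 * Gr.krad j ≤ ηP)
    -- the specification, the horizon and the automaton
    (φ : Spec AP) (H : ℕ) (𝒜 : Automaton AP S) (h𝒜 : 𝒜.EquivSpec φ H)
    -- the library of local networks and the selection computed by dynamic programming
    (𝔏 : Library Gr) (Γ : ℕ → Fin N → S → Fin M) (hΓ : Gr.IsSelection 𝒜 H Γ)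
    -- the constants
    (μ : Measure Sys.X) (l b : Fin N → Sys.X → ℝ)
    (hl : LipschitzInState Gr μ l) (hb : LipschitzInAction Gr μ b)
    (Lnet : Fin N → ℝ≥0) (hLnet : ∀ i j, LipschitzOnWith (Lnet i) (𝔏.net i j).eval (Gr.cell i))
    (LX : ℝ) (hLX : ∀ x ∈ Sys.X, ‖x‖ ≤ LX) (hLX1 : 1 ≤ LX)
    (LP : ℝ) (hLP : ∀ K ∈ Gr.ctrl, opNorm K ≤ LP)
    -- an admissible controller
    (Cstar : Controller Sys S) (hC : Cstar.Admissible Gr) :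
    -- if it is optimal for `φ` among the admissible controllers, the bound holds
    ((∀ x ∈ Sys.X₀, ∀ s ∈ 𝒜.init, ∀ C : Controller Sys S, C.Admissible Gr →
        C.satProb Lab 𝒜 φ H x s ≤ Cstar.satProb Lab 𝒜 φ H x s) →
      ∀ x ∈ Sys.X₀, ∀ s ∈ 𝒜.init,
        |(planner 𝔏 Γ).satProb Lab 𝒜 φ H x s - Cstar.satProb Lab 𝒜 φ H x s| ≤
          H * Fintype.card S *
            (deltaNN n m (fun i => ∫ y, l i y ∂μ) (fun i => ∫ y, b i y ∂μ) Lnet LX ηq ηP +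
              deltaStar n m (fun i => ∫ y, l i y ∂μ) (fun i => ∫ y, b i y ∂μ) LP LX ηq ηP)) ∧
    -- the same for the product with the automaton started in an arbitrary product state
    ((∀ x s, ∀ C : Controller Sys S, C.Admissible Gr →
        C.reachProb Lab 𝒜 H x s ≤ Cstar.reachProb Lab 𝒜 H x s) →
      ∀ x s,
        |(planner 𝔏 Γ).reachProb Lab 𝒜 H x s - Cstar.reachProb Lab 𝒜 H x s| ≤
          H * Fintype.card S *
            (deltaNN n m (fun i => ∫ y, l i y ∂μ) (fun i => ∫ y, b i y ∂μ) Lnet LX ηq ηP +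
              deltaStar n m (fun i => ∫ y, l i y ∂μ) (fun i => ∫ y, b i y ∂μ) LP LX ηq ηP)) := by
  refine ⟨fun h x hx s hs => ?_, fun h x s => ?_⟩
  · have hle := h x hx s hs _ (planner_admissible 𝔏 Γ)
    rw [satProb_eq_reachProb _ h𝒜 x hs, satProb_eq_reachProb _ h𝒜 x hs] at hle ⊢
    exact abs_reachProb_planner_sub_le hηq hηP 𝔏 hΓ hl hb hLnet hLX hLX1 hLP hC _ _ hle
  · exact abs_reachProb_planner_sub_le hηq hηP 𝔏 hΓ hl hb hLnet hLX hLX1 hLP hC x s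
      (h x s _ (planner_admissible 𝔏 Γ))
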